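/- Let $p$ be a prime, $q=p^\alpha$, and let $\gamma$ be a generator of the cyclic group $\mathbb F_q^*$. The group $\mathrm{AGL}(1,\mathbb F_q)=\left\{\begin{bmatrix}a&b\\0&1\end{bmatrix}:a\in\mathbb F_q^*,\,b\in\mathbb F_q\right\}$ acts on $\mathbb F_q$ by $\begin{bmatrix}a&b\\0&1\end{bmatrix}x=ax+b$. For $a\in\mathbb F_q^*$, $b\in\mathbb F_q$ and an additive subgroup $H$ of $\mathbb F_q$, let $S(a,b,H)$ be the subgroup of $\mathrm{AGL}(1,\mathbb F_q)$ generated by $\begin{bmatrix}a&b\\0&1\end{bmatrix}$ and all $\begin{bmatrix}1&h\\0&1\end{bmatrix}$ with $h\in H$, and let $H'=\{x\in\mathbb F_q:xH\subseteq H\}$. For a subgroup $S$ of $\mathrm{AGL}(1,\mathbb F_q)$ and $0\le k\le q$, let $\mathcal N(S,k)$ be the number of $k$-element subsets $B\subseteq\mathbb F_q$ whose setwise stabilizer in $\mathrm{AGL}(1,\mathbb F_q)$ is exactly $S$. For a positive integer $u$, let $\mathcal P(u)$ be the set of prime divisors of $u$, and, if $\gcd(u,v)=1$, let $o_u(v)$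 be the multiplicative order of $v$ modulo $u$ (so $o_1(v)=1$). For a finite set $P$ of integers, let $\Pi P=\prod_{e\in P}e$ (with $\Pi\emptyset=1$). Let ${n\brack m}_Q=\prod_{i=0}^{m-1}\frac{1-Q^{n-i}}{1-Q^{i+1}}$, and for integers $u,v>0$ let $$s_{q,k}(u,v)=\binom{(q-v)/uv}{k/uv}+\binom{(q-v)/uv}{(k-v)/uv},$$ where $\binom xy=x(x-1)\cdots(x-y+1)/y!$ if $y$ is a nonnegative integer and $\binom xy=0$ otherwise. **Theorem 4.3.** Let $d$ be an integer with $1<d\mid q-1$, let $H$ be a subspace of $\mathbb F_q$ over the subfield $\mathbb F_p(\gamma^{(q-1)/d})=\mathbb F_{p^{o_d(p)}}$, and let $|H|=p^\beta$. Then for $0\le k\le q$, $$\mathcal N\bigl(S(\gamma^{(q-1)/d},0,H),k\bigr)=\sum_{P\subseteq\mathcal P((|H'|-1)/d)}\ \sum_{0\le l\le(\alpha-\beta)/o_{d\Pi P}(p)}(-1)^{|P|+l}\,p^{o_{d\Pi P}(p)\binom l2}{(\alpha-\beta)/o_{d\Pi P}(p)\brack l}_{p^{o_{d\Pi P}(p)}}\,s_{q,k}\bigl(d\,\Pi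 P,\;p^{\beta+l\,o_{d\Pi P}(p)}\bigr).$$ -/

import Mathlib

open scoped Pointwise MatrixGroups

noncomputable section

namespace AffineLine

/-- The affine linear group `AGL(1, F)`: the invertible `2 × 2` matrices with second row `(0, 1)`. -/
def AGL (F : Type*) [Field F] : Subgroup (GL (Fin 2) F) where
  carrier := {g | g 1 0 = 0 ∧ g 1 1 = 1}
  one_mem' := by simp
  mul_mem' := by
    rintro g h ⟨hg0, hg1⟩ ⟨hh0, hh1⟩
    simp [Matrix.mul_apply, Fin.sum_univ_two, hg0, hg1, hh0, hh1]
  inv_mem' := by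
    rintro g ⟨hg0, hg1⟩
    have hdet : (g : Matrix (Fin 2) (Fin 2) F).det = g 0 0 := by
      simp [Matrix.det_fin_two, hg0, hg1]
    have hne : g 0 0 ≠ 0 := by
      rw [← hdet]
      exact ((Matrix.isUnit_iff_isUnit_det _).1 g.isUnit).ne_zero
    simp [Matrix.coe_units_inv, Matrix.inv_def, Matrix.adjugate_fin_two, hdet, hg0, hne]

/-- The action of `AGL(1, F)` on `F`: the matrix `[a b; 0 1]` sends `x` to `a * x + b`. -/
instance aglAction (F : Type*) [Field F] : MulAction (AGL F) F where
  smul g x := g.1 0 0 * x + g.1 0 1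
  one_smul x := by
    change (1 : GL (Fin 2) F) 0 0 * x + (1 : GL (Fin 2) F) 0 1 = x
    simp
  mul_smul g h x := by
    change (g.1 * h.1) 0 0 * x + (g.1 * h.1) 0 1
      = g.1 0 0 * (h.1 0 0 * x + h.1 0 1) + g.1 0 1
    have h0 : h.1 1 0 = 0 := h.2.1
    have h1 : h.1 1 1 = 1 := h.2.2
    simp [Matrix.mul_apply, Fin.sum_univ_two, h0, h1]
    ring

/-- The element `[a b; 0 1]` of `AGL(1, F)`. -/
def aff {F : Type*} [Field F] (a : Fˣ) (b : F) : AGL F :=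
  ⟨Matrix.GeneralLinearGroup.mkOfDetNeZero !![(a : F), b; 0, 1]
      (by simp [Matrix.det_fin_two]),
    by constructor <;> simp [Matrix.GeneralLinearGroup.mkOfDetNeZero]⟩

/-- The set of triples `(a, b, H)` with `a ∈ Fˣ`, with `H` an additive subgroup of `F` that is a
vector space over `𝔽_p(a)` (the smallest subfield containing `a`), and with `b = 0` if `a = 1`. -/
def triples (F : Type*) [Field F] : Set (Fˣ × F × AddSubgroup F) :=
  {t | (∀ c ∈ Subfield.closure {(t.1 : F)}, ∀ h ∈ t.2.2, c * h ∈ t.2.2) ∧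
    (t.1 = 1 → t.2.1 = 0)}

/-- `S(a, b, H)`, the subgroup generated by `[a b; 0 1]` and all `[1 h; 0 1]` with `h ∈ H`. -/
def subgroupS {F : Type*} [Field F] (a : Fˣ) (b : F) (H : AddSubgroup F) : Subgroup (AGL F) :=
  Subgroup.closure ({aff a b} ∪ {g | ∃ h ∈ H, g = aff 1 h})

/-- `𝒩(S, k)`, the number of `k`-element subsets `B` of `F` whose setwise stabilizer in
`AGL(1, F)` is exactly `S` (meant for finite `F`). -/
def numStab {F : Type*} [Field F] (S : Subgroup (AGL F)) (k : ℕ) : ℕ :=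
  {B : Set F | B.ncard = k ∧ MulAction.stabilizer (AGL F) B = S}.ncard

/-- `H' = {x ∈ F : x H ⊆ H}`. -/
def multiplierSet {F : Type*} [Field F] (H : AddSubgroup F) : Set F :=
  {x | ∀ h ∈ H, x * h ∈ H}

/-- The binomial coefficient `x(x-1)⋯(x-y+1)/y!` of rational numbers, set to `0` if `y ∉ ℕ`. -/
def binom (x y : ℚ) : ℚ :=
  open Classical in if ∃ n : ℕ, (n : ℚ) = y then Ring.choose x ⌊y⌋₊ else 0

/-- `s_{q,k}(u, v) = binom ((q-v)/uv) (k/uv) + binom ((q-v)/uv) ((k-v)/uv)`, all the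
divisions and subtractions being in `ℚ`. -/
def sFun (q k u v : ℕ) : ℚ :=
  binom (((q : ℚ) - v) / (u * v)) ((k : ℚ) / (u * v)) +
    binom (((q : ℚ) - v) / (u * v)) (((k : ℚ) - v) / (u * v))

/-- The Gaussian binomial coefficient `[n, m]_Q = ∏_{i < m} (1 - Q^(n-i)) / (1 - Q^(i+1))`, for
`Q ≥ 2`. (If `m > n`, the product has the factor `1 - Q^0 = 0`.) -/
def qBinom (Q n m : ℕ) : ℚ :=
  ∏ i ∈ Finset.range m, (1 - (Q : ℚ) ^ (n - i)) / (1 - (Q : ℚ) ^ (i + 1))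

/-- `o_u(v)`, the multiplicative order of `v` modulo `u`. -/
def ordMod (u v : ℕ) : ℕ := orderOf (v : ZMod u)

end AffineLine

end

/-! Write `a` for the chosen power of `γ`, of order `d > 1`. Because `1 - a` is invertible in the
field generated by `a`, the stabilizer of `B` is `S(a, 0, H)` exactly when its translation part is
`H` and its homothety part is `⟨a⟩` (`stabilizer_eq_subgroupS_iff`). Two inversions turn these exact
conditions into countable ones.

If the translation part is `H`, the homothety part lies in the cyclic group of nonzero elements of
the field `H'` (`stabilizer_le_multiplier`), so it equals `⟨a⟩` iff its order is `d`.
Inclusion-exclusion over primes dividing `(|H'| - 1) / d` (`sum_neg_one_pow_card_dvd`) reduces this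
to requiring invariance under some `c` of order `d * ∏ P`.

For such a `c`, the translation part of a `c`-invariant set is a subspace over the field generated
by `c`, and Möbius inversion on the lattice of subspaces containing `H` (`sum_qBinom_mul_sFun`)
reduces equality with `H` to containment of a subspace `K`. The sets invariant under `c` and `K` are
unions of orbits: `K` itself, and orbits of size `orderOf c * |K|`. This gives `sFun`
(`ncard_invariant`). -/

namespace AffineLine

open Module Finset

/-! ### Gaussian binomial coefficients. -/

section QBinomial

theorem qBinom_zero (Q n : ℕ) : qBinom Q n 0 = 1 := by simp [qBinom]

theorem qBinom_eq_zero_of_lt (Q : ℕ) {n l : ℕ} (h : n < l) : qBinom Q n l = 0 :=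
  Finset.prod_eq_zero (Finset.mem_range.2 h) (by simp)

theorem one_sub_pow_ne_zero {Q : ℕ} (hQ : 1 < Q) (i : ℕ) : (1 - (Q : ℚ) ^ (i + 1)) ≠ 0 := by
  have : (1 : ℚ) < (Q : ℚ) ^ (i + 1) := one_lt_pow₀ (by exact_mod_cast hQ) (by omega)
  linarith

theorem qBinom_succ_mul {Q : ℕ} (hQ : 1 < Q) (n l : ℕ) :
    qBinom Q n (l + 1) * (1 - (Q : ℚ) ^ (l + 1)) = qBinom Q n l * (1 - (Q : ℚ) ^ (n - l)) := by
  have := one_sub_pow_ne_zero hQ l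
  rw [qBinom, Finset.prod_range_succ, ← qBinom]
  field_simp

theorem qBinom_succ_left_mul {Q : ℕ} (hQ : 1 < Q) {n l : ℕ} (h : l ≤ n) :
    qBinom Q (n + 1) l * (1 - (Q : ℚ) ^ (n + 1 - l)) = qBinom Q n l * (1 - (Q : ℚ) ^ (n + 1)) := by
  induction l with
  | zero => simp [qBinom_zero]
  | succ l ih =>
    have h0 := one_sub_pow_ne_zero hQ l
    have h1 := qBinom_succ_mul hQ n l
    have h2 := qBinom_succ_mul hQ (n + 1) l
    have h3 := ih (by omega)
    have e : n + 1 - (l + 1) = n - l := by omega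
    rw [e]
    apply mul_right_cancel₀ h0
    calc _ = (qBinom Q (n + 1) (l + 1) * (1 - (Q : ℚ) ^ (l + 1))) * (1 - (Q : ℚ) ^ (n - l)) := by
            ring
      _ = (qBinom Q n l * (1 - (Q : ℚ) ^ (n - l))) * (1 - (Q : ℚ) ^ (n + 1)) := by
            rw [h2, h3]; ring
      _ = _ := by rw [← h1]; ring

/-- Pascal's rule for Gaussian binomial coefficients. -/
theorem qBinom_succ_succ {Q : ℕ} (hQ : 1 < Q) (n l : ℕ) :
    qBinom Q (n + 1) (l + 1) = (Q : ℚ) ^ (l + 1) * qBinom Q n (l + 1) + qBinom Q n l := by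
  have h0 := one_sub_pow_ne_zero hQ l
  rcases lt_trichotomy n l with h | rfl | h
  · rw [qBinom_eq_zero_of_lt Q h, qBinom_eq_zero_of_lt Q (show n < l + 1 by omega),
      qBinom_eq_zero_of_lt Q (show n + 1 < l + 1 by omega)]
    simp
  · rw [qBinom_eq_zero_of_lt Q (Nat.lt_succ_self n)]
    have h2 := qBinom_succ_mul hQ (n + 1) n
    have h3 := qBinom_succ_left_mul hQ (le_refl n)
    apply mul_right_cancel₀ h0
    rw [h2, h3]; ring
  · have h1 := qBinom_succ_mul hQ n l
    have h2 := qBinom_succ_mul hQ (n + 1) l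
    have h3 := qBinom_succ_left_mul hQ h.le
    apply mul_right_cancel₀ h0
    rw [h2, h3, add_mul, mul_assoc, h1]
    obtain ⟨m, rfl⟩ := Nat.exists_eq_add_of_lt h
    have e : l + m + 1 - l = m + 1 := by omega
    rw [e]
    ring

/-- This is the identity behind Möbius inversion on subspaces. By Pascal's rule the partial sums
telescope to a single term, which vanishes once the whole range is covered. -/
theorem sum_neg_one_pow_mul_qBinom {Q : ℕ} (hQ : 1 < Q) (n : ℕ) :
    ∑ l ∈ range (n + 1), (-1 : ℚ) ^ l * (Q : ℚ) ^ l.choose 2 * qBinom Q n l =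
      if n = 0 then 1 else 0 := by
  cases n with
  | zero => simp [qBinom_zero]
  | succ n =>
    have key : ∀ m, ∑ l ∈ range (m + 1), (-1 : ℚ) ^ l * (Q : ℚ) ^ l.choose 2 * qBinom Q (n + 1) l =
        (-1 : ℚ) ^ m * (Q : ℚ) ^ (m + 1).choose 2 * qBinom Q n m := by
      intro m
      induction m with
      | zero => simp [qBinom_zero]
      | succ m ih =>
        rw [sum_range_succ, ih, qBinom_succ_succ hQ]
        have e : (m + 1 + 1).choose 2 = (m + 1) + (m + 1).choose 2 := by
          rw [Nat.choose_succ_succ']; simp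
        rw [e, pow_add]
        ring
    rw [key, qBinom_eq_zero_of_lt Q (Nat.lt_succ_self n)]
    simp

end QBinomial

/-! ### Counting subspaces, and the Möbius function of their lattice. -/

section Subspaces

variable (E V : Type*) [Field E] [Finite E] [AddCommGroup V] [Module E V] [Finite V]

theorem natCard_linearIndependent {l : ℕ} (hl : l ≤ finrank E V) :
    Nat.card {s : Fin l → V // LinearIndependent E s} =
      ∏ i : Fin l, (Nat.card E ^ finrank E V - Nat.card E ^ (i : ℕ)) := by
  classical
  have := Fintype.ofFinite E
  have := Fintype.ofFinite V
  rw [Nat.card_eq_fintype_card (α := E)]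
  exact card_linearIndependent hl

/-- Linearly independent families spanning `W` are linearly independent families in `W`. -/
def spanFiberEquiv (l : ℕ) (W : Submodule E V) (hW : finrank E W = l) :
    {s : {s : Fin l → V // LinearIndependent E s} // Submodule.span E (Set.range s.1) = W} ≃
      {t : Fin l → W // LinearIndependent E t} where
  toFun s := ⟨fun i => ⟨s.1.1 i, s.2.le (Submodule.subset_span ⟨i, rfl⟩)⟩,
    LinearIndependent.of_comp W.subtype s.1.2⟩
  invFun t := ⟨⟨fun i => (t.1 i : V), t.2.map' W.subtype W.ker_subtype⟩, by
    apply Submodule.eq_of_le_of_finrank_eq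
    · rw [Submodule.span_le]
      rintro _ ⟨i, rfl⟩
      exact (t.1 i).2
    · exact (finrank_span_eq_card (t.2.map' W.subtype W.ker_subtype)).trans
        ((Fintype.card_fin l).trans hW.symm)⟩
  left_inv _ := rfl
  right_inv _ := rfl

/-- Double count of the independent `l`-tuples in `V`: sort them by their span, each span `W` being
hit once for every ordered basis of `W`. -/
theorem natCard_submodule_mul (l : ℕ) (hl : l ≤ finrank E V) :
    Nat.card {W : Submodule E V // finrank E W = l} *
      ∏ i : Fin l, (Nat.card E ^ l - Nat.card E ^ (i : ℕ)) =
      ∏ i : Fin l, (Nat.card E ^ finrank E V - Nat.card E ^ (i : ℕ)) := by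
  classical
  have := Fintype.ofFinite {W : Submodule E V // finrank E W = l}
  rw [← natCard_linearIndependent E V hl]
  let f : {s : Fin l → V // LinearIndependent E s} → {W : Submodule E V // finrank E W = l} :=
    fun s => ⟨Submodule.span E (Set.range s.1), by
      rw [finrank_span_eq_card s.2, Fintype.card_fin]⟩
  rw [← Nat.card_congr (Equiv.sigmaFiberEquiv f), Nat.card_sigma, Finset.sum_congr rfl
    (g := fun _ => ∏ i : Fin l, (Nat.card E ^ l - Nat.card E ^ (i : ℕ)))]
  · simp
  · rintro ⟨W, hW⟩ -
    have e : Nat.card {s // f s = ⟨W, hW⟩} =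
        Nat.card {s : {s : Fin l → V // LinearIndependent E s} //
          Submodule.span E (Set.range s.1) = W} :=
      Nat.card_congr (Equiv.subtypeEquivRight fun s => Subtype.ext_iff)
    rw [e, Nat.card_congr (spanFiberEquiv E V l W hW), natCard_linearIndependent E W hW.ge, hW]

theorem natCard_submodule_finrank_eq (l : ℕ) :
    (Nat.card {W : Submodule E V // finrank E W = l} : ℚ) =
      qBinom (Nat.card E) (finrank E V) l := by
  have hQ : 1 < Nat.card E := Finite.one_lt_card
  rcases lt_or_ge (finrank E V) l with h | h
  · rw [qBinom_eq_zero_of_lt _ h]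
    have : IsEmpty {W : Submodule E V // finrank E W = l} :=
      ⟨fun W => absurd (Submodule.finrank_le W.1) (by rw [W.2]; omega)⟩
    simp
  · have key := natCard_submodule_mul E V l h
    generalize Nat.card E = Q at *
    generalize finrank E V = n at *
    -- The factors `-Q ^ i` do not depend on `m`, so they cancel between the cases `m = l` and `m =
    -- n`; the rest is `qBinom` up to reversing one product.
    have cast : ∀ m, l ≤ m → ((∏ i : Fin l, (Q ^ m - Q ^ (i : ℕ)) : ℕ) : ℚ) =
        ∏ i ∈ range l, (-(Q : ℚ) ^ i * (1 - (Q : ℚ) ^ (m - i))) := by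
      intro m hm
      rw [← Fin.prod_univ_eq_prod_range (fun i => -(Q : ℚ) ^ i * (1 - (Q : ℚ) ^ (m - i))),
        Nat.cast_prod]
      refine Finset.prod_congr rfl fun i _ => ?_
      have hi : (i : ℕ) ≤ m := i.2.le.trans hm
      rw [Nat.cast_sub (Nat.pow_le_pow_right hQ.le hi)]
      push_cast
      rw [mul_sub, neg_mul, neg_mul, ← pow_add, Nat.add_sub_cancel' hi]
      ring
    have key' := congrArg (Nat.cast : ℕ → ℚ) key
    rw [Nat.cast_mul, cast l le_rfl, cast n h, prod_mul_distrib, prod_mul_distrib] at key'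
    have hne : ∏ i ∈ range l, (-(Q : ℚ) ^ i) ≠ 0 :=
      Finset.prod_ne_zero_iff.2 fun i _ => neg_ne_zero.2 (pow_ne_zero _ (by positivity))
    have hrefl : ∏ i ∈ range l, (1 - (Q : ℚ) ^ (l - i)) =
        ∏ i ∈ range l, (1 - (Q : ℚ) ^ (i + 1)) := by
      rw [← Finset.prod_range_reflect (fun i => 1 - (Q : ℚ) ^ (i + 1))]
      refine Finset.prod_congr rfl fun i hi => ?_
      rw [Finset.mem_range] at hi
      congr 2
      omega
    have hne2 : ∏ i ∈ range l, (1 - (Q : ℚ) ^ (i + 1)) ≠ 0 :=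
      Finset.prod_ne_zero_iff.2 fun i _ => one_sub_pow_ne_zero hQ i
    rw [qBinom, Finset.prod_div_distrib, eq_div_iff hne2]
    apply mul_left_cancel₀ hne
    rw [← key', hrefl]
    ring

/-- Grouping a sum over all subspaces by dimension. -/
theorem sum_submodule_eq [Fintype (Submodule E V)] (g : ℕ → ℚ) :
    ∑ W : Submodule E V, g (finrank E W) =
      ∑ l ∈ range (finrank E V + 1), qBinom (Nat.card E) (finrank E V) l * g l := by
  classical
  rw [← Finset.sum_fiberwise_of_maps_to (t := range (finrank E V + 1))
    (g := fun W : Submodule E V => finrank E W)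
    (fun W _ => Finset.mem_range.2 (Nat.lt_succ_of_le (Submodule.finrank_le W)))]
  refine Finset.sum_congr rfl fun l _ => ?_
  rw [Finset.sum_congr rfl (g := fun _ => g l) (fun W hW => by rw [(Finset.mem_filter.1 hW).2]),
    Finset.sum_const, nsmul_eq_mul, ← natCard_submodule_finrank_eq, Nat.card_eq_fintype_card,
    Fintype.card_subtype]

theorem sum_submodule_mobius [Fintype (Submodule E V)] :
    ∑ W : Submodule E V, (-1 : ℚ) ^ finrank E W * (Nat.card E : ℚ) ^ (finrank E W).choose 2 =
      if finrank E V = 0 then 1 else 0 := by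
  rw [sum_submodule_eq E V fun l => (-1 : ℚ) ^ l * (Nat.card E : ℚ) ^ l.choose 2,
    ← sum_neg_one_pow_mul_qBinom (Finite.one_lt_card (α := E))]
  exact Finset.sum_congr rfl fun l _ => by ring

variable {E V} in
-- The summand is the Möbius function from `⊥` to `W`. Subspaces below `M` are the subspaces of `M`,
-- so the sum over the whole lattice of `M` applies.
theorem sum_submodule_le_mobius [Fintype (Submodule E V)] (M : Submodule E V)
    [DecidablePred fun W : Submodule E V => W ≤ M] [Decidable (M = ⊥)] :
    ∑ W : Submodule E V with W ≤ M,
      (-1 : ℚ) ^ finrank E W * (Nat.card E : ℚ) ^ (finrank E W).choose 2 =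
      if M = ⊥ then 1 else 0 := by
  have := Fintype.ofFinite (Submodule E M)
  rw [← if_congr (Submodule.finrank_eq_zero (S := M)) rfl rfl, ← sum_submodule_mobius E M]
  symm
  refine Finset.sum_bij (fun W _ => W.map M.subtype) ?_ ?_ ?_ ?_
  · intro W _
    simpa using Submodule.map_subtype_le M W
  · intro W _ W' _ h
    exact Submodule.map_injective_of_injective M.subtype_injective h
  · intro W hW
    refine ⟨W.comap M.subtype, Finset.mem_univ _, ?_⟩
    rw [Submodule.map_comap_subtype]
    exact inf_eq_right.2 (Finset.mem_filter.1 hW).2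
  · intro W _
    rw [Submodule.finrank_map_subtype_eq]

end Subspaces

/-! ### Subsets of prescribed weight. -/

section Counting

/-- The default value `0` of `binom` is the right count for `y ∉ ℕ`, so no divisibility cases are
needed later. -/
theorem binom_card {ι : Type*} (A : Finset ι) (y : ℚ) :
    binom (#A : ℚ) y = (#{T ∈ A.powerset | (#T : ℚ) = y} : ℚ) := by
  classical
  unfold binom
  split_ifs with h
  · obtain ⟨n, rfl⟩ := h
    rw [Nat.floor_natCast, Ring.choose_natCast, ← card_powersetCard, powersetCard_eq_filter]
    simp
  · rw [eq_comm, Nat.cast_eq_zero, card_eq_zero, filter_eq_empty_iff]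
    exact fun T _ hT => h ⟨_, hT⟩

/-- The number of subsets of given total weight, when one point `o` has weight `v` and all the
others have weight `m`. -/
theorem card_weight_eq {ι : Type*} [Fintype ι] [DecidableEq ι] (o : ι) (v m k : ℕ) (hm : m ≠ 0) :
    (#{T : Finset ι | ∑ t ∈ T, (if t = o then v else m) = k} : ℚ) =
      binom (#(univ.erase o)) (k / m) + binom (#(univ.erase o)) ((k - v) / m) := by
  have hm' : (m : ℚ) ≠ 0 := by exact_mod_cast hm
  have hw : ∀ T : Finset ι, o ∉ T → ∑ t ∈ T, (if t = o then v else m) = #T * m := by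
    intro T hT
    rw [sum_congr rfl (g := fun _ => m), sum_const, smul_eq_mul]
    intro t ht
    rw [if_neg]
    rintro rfl
    exact hT ht
  -- A subset avoiding `o` needs `k / m` other points, one containing `o` needs `(k - v) / m`.
  rw [binom_card, binom_card, ← card_filter_add_card_filter_not (fun T => o ∉ T), Nat.cast_add]
  congr 2
  · congr 1
    ext T
    simp only [mem_filter, mem_univ, true_and, mem_powerset, subset_erase, subset_univ]
    rw [and_comm]
    refine and_congr_right fun hT => ?_
    rw [hw T hT, eq_div_iff hm']
    norm_cast
  · refine (card_bij (fun T _ => insert o T) ?_ ?_ ?_).symm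
    · intro T hT
      simp only [mem_filter, mem_powerset, subset_erase] at hT
      obtain ⟨⟨-, hT⟩, h⟩ := hT
      rw [eq_div_iff hm', eq_sub_iff_add_eq] at h
      simp only [mem_filter, mem_univ, true_and, mem_insert, true_or, not_true, not_false_iff,
        and_true]
      rw [sum_insert hT, hw T hT, if_pos rfl, add_comm]
      exact_mod_cast h
    · intro T hT T' hT' h
      simp only [mem_filter, mem_powerset, subset_erase] at hT hT'
      rw [← erase_insert hT.1.2, h, erase_insert hT'.1.2]
    · intro T hT
      simp only [mem_filter, mem_univ, true_and, not_not] at hT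
      obtain ⟨h, ho⟩ := hT
      refine ⟨T.erase o, ?_, insert_erase ho⟩
      simp only [mem_filter, mem_powerset]
      refine ⟨erase_subset_erase _ (subset_univ _), ?_⟩
      rw [← insert_erase ho, sum_insert (notMem_erase o T), hw _ (notMem_erase o T), if_pos rfl] at h
      rw [eq_div_iff hm', eq_sub_iff_add_eq, add_comm]
      exact_mod_cast h

end Counting

/-! ### Orbits of `x ↦ g * x + h` and invariant sets. -/

section Orbits

variable {F : Type*} [Field F]

theorem zpowers_mem_closure {c g : Fˣ} (hg : g ∈ Subgroup.zpowers c) :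
    (g : F) ∈ Subfield.closure {(c : F)} := by
  obtain ⟨i, rfl⟩ := hg
  have : (c : F) ∈ Subfield.closure {(c : F)} := Subfield.subset_closure rfl
  simpa only [Units.val_zpow_eq_zpow_val] using zpow_mem this i

/-- The relation of lying in the same orbit under the maps `x ↦ g * x + h` with `g` a power of `c`
and `h ∈ K`. -/
def orbitSetoid (c : Fˣ) (K : AddSubgroup F)
    (hK : ∀ e ∈ Subfield.closure {(c : F)}, ∀ h ∈ K, e * h ∈ K) : Setoid F where
  r x y := ∃ g ∈ Subgroup.zpowers c, y - g * x ∈ K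
  iseqv := by
    refine ⟨fun x => ⟨1, one_mem _, by simp⟩, ?_, ?_⟩
    · rintro x y ⟨g, hg, h⟩
      refine ⟨g⁻¹, inv_mem hg, ?_⟩
      have := K.neg_mem (hK _ (zpowers_mem_closure (inv_mem hg)) _ h)
      rw [mul_sub, Units.inv_mul_cancel_left, neg_sub] at this
      exact this
    · rintro x y z ⟨g, hg, h⟩ ⟨g', hg', h'⟩
      refine ⟨g' * g, mul_mem hg' hg, ?_⟩
      have := K.add_mem h' (hK _ (zpowers_mem_closure hg') _ h)
      push_cast
      convert this using 1
      ring

variable (c : Fˣ) (K : AddSubgroup F)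
  (hK : ∀ e ∈ Subfield.closure {(c : F)}, ∀ h ∈ K, e * h ∈ K)

/-- Off `K` the action is free: two coincident images give `(g - g') * x ∈ K`, and if `g ≠ g'`,
dividing by `g - g'` inside the field generated by `c` puts `x` in `K`. -/
theorem natCard_orbit (x : F) [Decidable (x ∈ K)] :
    Nat.card {y | orbitSetoid c K hK x y} =
      if x ∈ K then Nat.card K else orderOf c * Nat.card K := by
  split_ifs with hx
  · apply Nat.card_congr
    refine Equiv.subtypeEquivRight fun y => ⟨?_, ?_⟩
    · rintro ⟨g, hg, h⟩
      simpa using K.add_mem h (hK _ (zpowers_mem_closure hg) _ hx)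
    · exact fun hy => ⟨1, one_mem _, by simpa using K.sub_mem hy hx⟩
  · rw [← Nat.card_zpowers, ← Nat.card_prod]
    let f : Subgroup.zpowers c × K → F := fun t => (t.1.1 : F) * x + t.2
    have hf : Function.Injective f := by
      rintro ⟨⟨g, hg⟩, ⟨h, hh⟩⟩ ⟨⟨g', hg'⟩, ⟨h', hh'⟩⟩ e
      simp only [f] at e
      have key : ((g : F) - g') * x ∈ K := by
        have := K.sub_mem hh' hh
        convert this using 1
        linear_combination e
      have hgg : (g : F) - g' = 0 := by
        by_contra hne
        have := hK _ (inv_mem (sub_mem (zpowers_mem_closure hg) (zpowers_mem_closure hg'))) _ key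
        rw [inv_mul_cancel_left₀ hne] at this
        exact hx this
      obtain rfl : g = g' := Units.ext (sub_eq_zero.1 hgg)
      obtain rfl : h = h' := by simpa using e
      rfl
    rw [← Nat.card_range_of_injective hf]
    apply Nat.card_congr
    refine Equiv.subtypeEquivRight fun y => ⟨?_, ?_⟩
    · rintro ⟨g, hg, h⟩
      exact ⟨(⟨g, hg⟩, ⟨_, h⟩), by simp [f]⟩
    · rintro ⟨⟨⟨g, hg⟩, ⟨h, hh⟩⟩, rfl⟩
      exact ⟨g, hg, by simpa [f] using hh⟩

theorem saturated_iff (B : Set F) :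
    (∀ x y, orbitSetoid c K hK x y → (x ∈ B ↔ y ∈ B)) ↔
      c ∈ MulAction.stabilizer Fˣ B ∧ K ≤ AddAction.stabilizer F B := by
  constructor
  · refine fun hB => ⟨?_, fun h hh => ?_⟩
    · rw [MulAction.mem_stabilizer_set]
      exact fun x => (hB x _ ⟨c, Subgroup.mem_zpowers c, by simp [Units.smul_def]⟩).symm
    · rw [AddAction.mem_stabilizer_set]
      exact fun x => (hB x _ ⟨1, one_mem _, by simpa using hh⟩).symm
  · rintro ⟨hc, hB⟩ x y ⟨g, hg, h⟩
    have h1 := MulAction.mem_stabilizer_set.1 ((Subgroup.zpowers_le.2 hc) hg) x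
    have h2 := AddAction.mem_stabilizer_set.1 (hB h) (g • x)
    rw [← h1, ← h2, Units.smul_def, vadd_eq_add, smul_eq_mul, sub_add_cancel]

/-- The number of `k`-subsets of `F` invariant under multiplication by `c` and translation
by `K`. -/
theorem ncard_invariant [Finite F] (hK : ∀ e ∈ Subfield.closure {(c : F)}, ∀ h ∈ K, e * h ∈ K) (k : ℕ) :
    ({B : Set F | B.ncard = k ∧ c ∈ MulAction.stabilizer Fˣ B ∧
      K ≤ AddAction.stabilizer F B}.ncard : ℚ) =
      sFun (Nat.card F) k (orderOf c) (Nat.card K) := by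
  classical
  have := Fintype.ofFinite F
  let r := orbitSetoid c K hK
  let π : F → Quotient r := Quotient.mk r
  have hπ : Function.Surjective π := Quotient.mk_surjective
  have hw : ∀ t : Quotient r, #{x : F | π x = t} =
      if t = π 0 then Nat.card K else orderOf c * Nat.card K := by
    intro t
    obtain ⟨x, rfl⟩ := hπ t
    have e : (π x = π 0) = (x ∈ K) := by
      refine propext (eq_comm.trans (Quotient.eq.trans ⟨?_, ?_⟩))
      · rintro ⟨g, hg, h⟩
        simpa using h
      · exact fun h => ⟨1, one_mem _, by simpa using h⟩
    simp only [e]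
    rw [← natCard_orbit c K hK x, Nat.card_eq_fintype_card, ← Set.toFinset_card]
    congr 1
    ext y
    simp only [mem_filter, mem_univ, true_and, Set.mem_toFinset, Set.mem_ofPred_eq]
    rw [eq_comm]
    exact Quotient.eq
  have hcard : ∀ T : Finset (Quotient r), {x | π x ∈ T}.ncard =
      ∑ t ∈ T, if t = π 0 then Nat.card K else orderOf c * Nat.card K := by
    intro T
    rw [Set.ncard_eq_toFinset_card', card_eq_sum_card_fiberwise (f := π) (t := T)]
    · refine sum_congr rfl fun t ht => ?_
      rw [← hw t]
      congr 1
      ext x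
      simp only [mem_filter, mem_univ, true_and, Set.mem_toFinset, Set.mem_ofPred_eq]
      exact ⟨fun h => h.2, fun h => ⟨h ▸ ht, h⟩⟩
    · intro x hx
      simpa using hx
  let φ : Finset (Quotient r) → Set F := fun T => {x | π x ∈ T}
  have hφ : Function.Injective φ := by
    intro T T' h
    ext t
    obtain ⟨x, rfl⟩ := hπ t
    exact Set.ext_iff.1 h x
  have himg : {B : Set F | B.ncard = k ∧ c ∈ MulAction.stabilizer Fˣ B ∧
      K ≤ AddAction.stabilizer F B} = φ '' ({T : Finset (Quotient r) | ∑ t ∈ T,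
        (if t = π 0 then Nat.card K else orderOf c * Nat.card K) = k} : Finset _) := by
    ext B
    simp only [Set.mem_ofPred_eq, coe_filter, mem_univ, true_and, Set.mem_image]
    rw [← saturated_iff c K hK]
    constructor
    · rintro ⟨hk, hB⟩
      have e : φ {t | ∃ x ∈ B, π x = t} = B := by
        ext x
        simp only [φ, mem_filter, mem_univ, true_and, Set.mem_ofPred_eq]
        exact ⟨fun ⟨y, hy, hyx⟩ => (hB y x (Quotient.exact hyx)).1 hy, fun hx => ⟨x, hx, rfl⟩⟩
      exact ⟨_, by rw [← hcard, ← hk]; exact congrArg Set.ncard e, e⟩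
    · rintro ⟨T, hT, rfl⟩
      refine ⟨(hcard T).trans hT, fun x y hxy => ?_⟩
      have : π x = π y := Quotient.sound hxy
      simp only [φ, Set.mem_ofPred_eq, this]
  have hm : orderOf c * Nat.card K ≠ 0 :=
    mul_ne_zero (orderOf_pos c).ne' Nat.card_pos.ne'
  -- Counting `F` by orbits, with `K` the orbit of `0`, yields the number of other orbits, the upper
  -- entry in `sFun`.
  have hq : Nat.card F = Nat.card K + #(univ.erase (π 0)) * (orderOf c * Nat.card K) := by
    have h := hcard univ
    rw [← add_sum_erase _ _ (mem_univ (π 0)), if_pos rfl, sum_congr rfl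
      (g := fun _ => orderOf c * Nat.card K) (fun t ht => if_neg (ne_of_mem_erase ht)),
      sum_const, smul_eq_mul] at h
    rw [← h, ← Set.ncard_univ]
    simp
  have hN : ((Nat.card F : ℚ) - Nat.card K) / (orderOf c * Nat.card K) =
      #(univ.erase (π 0)) := by
    have hm' : (orderOf c * Nat.card K : ℚ) ≠ 0 := by exact_mod_cast hm
    rw [div_eq_iff hm', hq]
    push_cast
    ring
  rw [himg, Set.ncard_image_of_injective _ hφ, Set.ncard_coe_finset, card_weight_eq _ _ _ _ hm,
    sFun, hN]
  push_cast
  rfl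

end Orbits

/-! ### The multiplier field of `H`, and the field generated by `c`. -/

section Multiplier

variable {F : Type*} [Field F] [Finite F]

/-- The multiplier set of an additive subgroup of a finite field is a subfield. -/
def multiplierSubfield (H : AddSubgroup F) : Subfield F where
  carrier := multiplierSet H
  one_mem' h hh := by simpa using hh
  zero_mem' h _ := by simp [H.zero_mem]
  mul_mem' := by
    intro x y hx hy h hh
    rw [mul_assoc]
    exact hx _ (hy _ hh)
  add_mem' := by
    intro x y hx hy h hh
    rw [add_mul]
    exact H.add_mem (hx _ hh) (hy _ hh)
  neg_mem' := by
    intro x hx h hh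
    rw [neg_mul]
    exact H.neg_mem (hx _ hh)
  inv_mem' := by
    intro x hx h hh
    rcases eq_or_ne x 0 with rfl | h0
    · simp [H.zero_mem]
    · let f : H → H := fun t => ⟨x * t, hx _ t.2⟩
      have hf : Function.Injective f := fun s t e =>
        Subtype.ext (mul_left_cancel₀ h0 (congrArg Subtype.val e))
      obtain ⟨t, ht⟩ := Finite.surjective_of_injective hf ⟨h, hh⟩
      have : x * (t : F) = h := congrArg Subtype.val ht
      rw [← this, inv_mul_cancel_left₀ h0]
      exact t.2

theorem closure_stable {H : AddSubgroup F} {c : F} (hc : c ∈ multiplierSubfield H) :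
    ∀ e ∈ Subfield.closure {c}, ∀ h ∈ H, e * h ∈ H :=
  (Subfield.closure_le (t := multiplierSubfield H)).2 (Set.singleton_subset_iff.2 hc)

/-- Conjugating translation by `t` with the homothety `c` gives translation by `c * t`. -/
theorem stabilizer_le_multiplier {B : Set F} {c : Fˣ} (hc : c ∈ MulAction.stabilizer Fˣ B) :
    (c : F) ∈ multiplierSubfield (AddAction.stabilizer F B) := by
  intro t ht
  rw [AddAction.mem_stabilizer_set] at ht ⊢
  rw [MulAction.mem_stabilizer_set] at hc
  intro x
  have h1 := hc (t + c⁻¹ • x)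
  have h2 := ht (c⁻¹ • x)
  have h3 := hc (c⁻¹ • x)
  rw [smul_inv_smul] at h3
  rw [smul_add, smul_inv_smul, Units.smul_def, smul_eq_mul] at h1
  exact h1.trans (h2.trans h3.symm)

/-- The group of units of a subfield, as a subgroup of the units of the field. -/
def unitsSubgroup (M : Subfield F) : Subgroup Fˣ := (Units.map M.subtype.toMonoidHom).range

omit [Finite F] in
theorem mem_unitsSubgroup {M : Subfield F} {x : Fˣ} : x ∈ unitsSubgroup M ↔ (x : F) ∈ M := by
  constructor
  · rintro ⟨y, rfl⟩
    exact (y : M).2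
  · intro h
    have h0 : (⟨x, h⟩ : M) ≠ 0 := fun e => x.ne_zero (congrArg Subtype.val e)
    exact ⟨Units.mk0 _ h0, Units.ext rfl⟩

omit [Finite F] in
theorem natCard_unitsSubgroup (M : Subfield F) : Nat.card (unitsSubgroup M) = Nat.card M - 1 := by
  rw [← Nat.card_units M]
  refine (Nat.card_congr (MonoidHom.ofInjective ?_).toEquiv).symm
  exact Units.map_injective M.subtype_injective

/-- `Fˣ` is cyclic, so `y ^ n = 1` has at most `n` solutions, and a subgroup of order `n` already
supplies them all. -/
theorem mem_subgroup_units_iff (K : Subgroup Fˣ) (x : Fˣ) : x ∈ K ↔ orderOf x ∣ Nat.card K := by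
  classical
  have := Fintype.ofFinite Fˣ
  constructor
  · intro hx
    have := orderOf_dvd_natCard (⟨x, hx⟩ : K)
    rwa [Subgroup.orderOf_mk] at this
  · intro hx
    have hsub : (univ.filter fun y => y ∈ K) ⊆
        (univ.filter fun y : Fˣ => y ^ Nat.card K = 1) := by
      intro y hy
      simp only [mem_filter, mem_univ, true_and] at hy ⊢
      exact orderOf_dvd_iff_pow_eq_one.1
        ((Subgroup.orderOf_mk y hy) ▸ orderOf_dvd_natCard (⟨y, hy⟩ : K))
    have hle := IsCyclic.card_pow_eq_one_le (α := Fˣ) (n := Nat.card K) Nat.card_pos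
    have hc : #(univ.filter fun y => y ∈ K) = Nat.card K := by
      rw [Nat.card_eq_fintype_card, Fintype.card_subtype]
    have heq := Finset.eq_of_subset_of_card_le hsub (hle.trans hc.ge)
    have : x ∈ univ.filter fun y => y ∈ K := by
      rw [heq]
      simpa using orderOf_dvd_iff_pow_eq_one.1 hx
    simpa using this

/-- If `|E| = p ^ m`, then `orderOf c ∣ p ^ m - 1` gives `o ∣ m`. Conversely the `o`-th Frobenius
iterate fixes `c`, hence `E`, so a generator of `Eˣ` has order dividing `p ^ o - 1`, forcing `m ≤
o`. -/
theorem natCard_closure {p α : ℕ} (hp : p.Prime) (hq : Nat.card F = p ^ α) (c : Fˣ) :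
    Nat.card (Subfield.closure {(c : F)}) = p ^ ordMod (orderOf c) p ∧
      0 < ordMod (orderOf c) p := by
  set E := Subfield.closure {(c : F)} with hE
  have hcE : (c : F) ∈ E := Subfield.subset_closure rfl
  obtain ⟨m, -, hm⟩ : ∃ m ≤ α, Nat.card E = p ^ m :=
    (Nat.dvd_prime_pow hp).1 (hq ▸ AddSubgroup.card_addSubgroup_dvd_card E.toAddSubgroup)
  have hE1 : 1 < Nat.card E := Finite.one_lt_card
  have hm0 : m ≠ 0 := by
    rintro rfl
    rw [hm, pow_zero] at hE1
    omega
  have hiff : ∀ i, ((p : ZMod (orderOf c)) ^ i = 1 ↔ orderOf c ∣ p ^ i - 1) := by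
    intro i
    rw [← Nat.cast_one, ← Nat.cast_pow, eq_comm, ZMod.natCast_eq_natCast_iff,
      Nat.modEq_iff_dvd' (Nat.pos_of_ne_zero (pow_ne_zero i hp.ne_zero))]
  have hpm : (p : ZMod (orderOf c)) ^ m = 1 := by
    rw [hiff, ← hm, ← natCard_unitsSubgroup]
    exact (mem_subgroup_units_iff _ c).1 (mem_unitsSubgroup.2 hcE)
  have hom : ordMod (orderOf c) p ∣ m := orderOf_dvd_of_pow_eq_one hpm
  have ho : 0 < ordMod (orderOf c) p := Nat.pos_of_dvd_of_pos hom (Nat.pos_of_ne_zero hm0)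
  refine ⟨hm.trans (congrArg _ (le_antisymm ?_ (Nat.le_of_dvd (Nat.pos_of_ne_zero hm0) hom))), ho⟩
  set o := ordMod (orderOf c) p
  have hco : orderOf c ∣ p ^ o - 1 := (hiff o).1 (pow_orderOf_eq_one _)
  have hα : α ≠ 0 := by
    rintro rfl
    have : 1 < Nat.card F := Finite.one_lt_card
    rw [hq, pow_zero] at this
    omega
  have : Fact p.Prime := ⟨hp⟩
  have hchar : CharP F p := by
    have := Fintype.ofFinite F
    rw [Nat.card_eq_fintype_card] at hq
    exact charP_of_card_eq_prime_pow hq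
  have hEle : E ≤ (iterateFrobenius F p o).eqLocusField (RingHom.id F) := by
    rw [hE, Subfield.closure_le, Set.singleton_subset_iff]
    change iterateFrobenius F p o c = c
    rw [iterateFrobenius_def]
    have h1 : c ^ (p ^ o - 1) = 1 := orderOf_dvd_iff_pow_eq_one.1 hco
    have h2 : c ^ (p ^ o) = c := by
      rw [← Nat.sub_add_cancel (Nat.one_le_pow o p hp.pos), pow_succ, h1, one_mul]
    exact_mod_cast congrArg Units.val h2
  obtain ⟨g, hg⟩ := IsCyclic.exists_ofOrder_eq_natCard (α := Eˣ)
  rw [Nat.card_units, hm] at hg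
  have hgo : g ^ (p ^ o - 1) = 1 := by
    have h1 : (((g : E) : F)) ^ (p ^ o) = g := hEle (g : E).2
    have h2 : g ^ (p ^ o) = g := Units.ext (Subtype.ext (by simpa using h1))
    rw [← Nat.sub_add_cancel (Nat.one_le_pow o p hp.pos), pow_succ] at h2
    exact mul_eq_right.1 h2
  have hdvd := orderOf_dvd_of_pow_eq_one hgo
  rw [hg] at hdvd
  have hpo : 1 < p ^ o := Nat.one_lt_pow ho.ne' hp.one_lt
  have := Nat.le_of_dvd (by omega) hdvd
  exact (Nat.pow_le_pow_iff_right hp.one_lt).1 (by omega)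

end Multiplier

/-! ### Möbius inversion over translation groups. -/

section SubspaceSum

variable {F : Type*} [Field F] [Finite F]

theorem natCard_comap_mkQ {R M : Type*} [Ring R] [AddCommGroup M] [Module R M] [Finite M]
    (N : Submodule R M) (W : Submodule R (M ⧸ N)) :
    Nat.card (W.comap N.mkQ) = Nat.card N * Nat.card W := by
  have : Finite (M ⧸ N) := Finite.of_surjective N.mkQ N.mkQ_surjective
  have h1 := Submodule.card_eq_card_quotient_mul_card N
  have h2 := AddSubgroup.card_mul_index (W.comap N.mkQ).toAddSubgroup
  have h3 := AddSubgroup.card_mul_index W.toAddSubgroup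
  have h4 : (W.comap N.mkQ).toAddSubgroup.index = W.toAddSubgroup.index :=
    AddSubgroup.index_comap_of_surjective (f := N.mkQ.toAddMonoidHom) W.toAddSubgroup
      N.mkQ_surjective
  rw [h4] at h2
  have hpos : 0 < W.toAddSubgroup.index := Nat.pos_of_ne_zero AddSubgroup.index_ne_zero_of_finite
  apply Nat.eq_of_mul_eq_mul_right hpos
  change Nat.card (W.comap N.mkQ) * W.toAddSubgroup.index = _ at h2
  change Nat.card W * W.toAddSubgroup.index = _ at h3
  rw [mul_assoc, h3, h2, h1, mul_comm]

/-- The translation stabilizer is a subspace `T` over the field of `c`. If `N ≤ T`, the sum runs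
over the subspaces of the image of `T` in `F ⧸ N`, which is `⊥` iff `T = N`; otherwise it is empty.
-/
theorem sum_mobius_stabilizer (c : Fˣ) (B : Set F) (hB : c ∈ MulAction.stabilizer Fˣ B)
    (N : Submodule (Subfield.closure {(c : F)}) F)
    [Fintype (Submodule (Subfield.closure {(c : F)}) (F ⧸ N))]
    [DecidablePred fun W : Submodule (Subfield.closure {(c : F)}) (F ⧸ N) =>
      (W.comap N.mkQ).toAddSubgroup ≤ AddAction.stabilizer F B]
    [Decidable (AddAction.stabilizer F B = N.toAddSubgroup)] :
    ∑ W : Submodule (Subfield.closure {(c : F)}) (F ⧸ N) with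
        (W.comap N.mkQ).toAddSubgroup ≤ AddAction.stabilizer F B,
      (-1 : ℚ) ^ finrank (Subfield.closure {(c : F)}) W *
        (Nat.card (Subfield.closure {(c : F)}) : ℚ) ^
          (finrank (Subfield.closure {(c : F)}) W).choose 2 =
      if AddAction.stabilizer F B = N.toAddSubgroup then 1 else 0 := by
  classical
  have : Finite (F ⧸ N) := Finite.of_surjective N.mkQ N.mkQ_surjective
  let T : Submodule (Subfield.closure {(c : F)}) F :=
    { AddAction.stabilizer F B with
      smul_mem' := fun e h hh => closure_stable (stabilizer_le_multiplier hB) e e.2 h hh }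
  have hT : T.toAddSubgroup = AddAction.stabilizer F B := rfl
  simp only [← hT, Submodule.toAddSubgroup_le, Submodule.toAddSubgroup_inj]
  by_cases hN : N ≤ T
  · have hiff : ∀ W : Submodule (Subfield.closure {(c : F)}) (F ⧸ N),
        W.comap N.mkQ ≤ T ↔ W ≤ T.map N.mkQ := by
      intro W
      constructor
      · intro h
        rw [← Submodule.map_comap_eq_of_surjective N.mkQ_surjective W]
        exact Submodule.map_mono h
      · intro h
        have := Submodule.comap_mono (f := N.mkQ) h
        rwa [Submodule.comap_map_mkQ, sup_eq_right.2 hN] at this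
    simp only [hiff]
    refine (sum_submodule_le_mobius (T.map N.mkQ)).trans (if_congr ?_ rfl rfl)
    rw [← le_bot_iff, Submodule.map_le_iff_le_comap, Submodule.comap_bot, Submodule.ker_mkQ]
    exact ⟨fun h => le_antisymm h hN, fun h => h.le⟩
  · rw [if_neg fun h => hN h.ge, Finset.filter_eq_empty_iff.2, Finset.sum_empty]
    exact fun W _ h => hN ((N.le_comap_mkQ W).trans h)

/-- Möbius inversion over the translation groups: the alternating sum counts the `k`-subsets
invariant under `c` whose translation stabilizer is exactly `H`. -/
theorem sum_qBinom_mul_sFun {p α β : ℕ} (hp : p.Prime) (hq : Nat.card F = p ^ α)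
    (H : AddSubgroup F) (hβ : Nat.card H = p ^ β) (c : Fˣ)
    (hc : (c : F) ∈ multiplierSubfield H) (k : ℕ) :
    ∑ l ∈ range ((α - β) / ordMod (orderOf c) p + 1),
      (-1 : ℚ) ^ l * (p : ℚ) ^ (ordMod (orderOf c) p * l.choose 2) *
        qBinom (p ^ ordMod (orderOf c) p) ((α - β) / ordMod (orderOf c) p) l *
        sFun (p ^ α) k (orderOf c) (p ^ (β + l * ordMod (orderOf c) p)) =
      ({B : Set F | (B.ncard = k ∧ AddAction.stabilizer F B = H) ∧
        c ∈ MulAction.stabilizer Fˣ B}.ncard : ℚ) := by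
  classical
  obtain ⟨hE, ho⟩ := natCard_closure hp hq c
  let N : Submodule (Subfield.closure {(c : F)}) F :=
    { H with smul_mem' := fun e h hh => closure_stable hc e e.2 h hh }
  have hNH : N.toAddSubgroup = H := rfl
  have hNc : Nat.card N = p ^ β := hβ
  have : Finite (F ⧸ N) := Finite.of_surjective N.mkQ N.mkQ_surjective
  have := Fintype.ofFinite (Set F)
  have := Fintype.ofFinite (Submodule (Subfield.closure {(c : F)}) (F ⧸ N))
  have hcardE : ∀ W : Submodule (Subfield.closure {(c : F)}) (F ⧸ N), Nat.card W =
      p ^ (finrank (Subfield.closure {(c : F)}) W * ordMod (orderOf c) p) := by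
    intro W
    rw [natCard_eq_pow_finrank (K := Subfield.closure {(c : F)}) (V := W), hE, ← pow_mul, mul_comm]
  set o := ordMod (orderOf c) p
  have hn : (α - β) / o = finrank (Subfield.closure {(c : F)}) (F ⧸ N) := by
    have h1 := Submodule.card_eq_card_quotient_mul_card N
    rw [natCard_eq_pow_finrank (K := Subfield.closure {(c : F)}) (V := F ⧸ N), hE, hNc, hq,
      ← pow_mul, ← pow_add] at h1
    have h2 := Nat.pow_right_injective hp.two_le h1
    rw [h2, Nat.add_sub_cancel_left, Nat.mul_div_cancel_left _ ho]
  have hinv : ∀ W : Submodule (Subfield.closure {(c : F)}) (F ⧸ N),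
      sFun (p ^ α) k (orderOf c) (p ^ (β + finrank (Subfield.closure {(c : F)}) W * o)) =
      ∑ B : Set F with B.ncard = k ∧ c ∈ MulAction.stabilizer Fˣ B,
        if (W.comap N.mkQ).toAddSubgroup ≤ AddAction.stabilizer F B then (1 : ℚ) else 0 := by
    intro W
    have h1 : Nat.card (W.comap N.mkQ).toAddSubgroup =
        p ^ (β + finrank (Subfield.closure {(c : F)}) W * o) := by
      rw [pow_add, ← hNc, ← hcardE]
      exact natCard_comap_mkQ N W
    rw [← h1, ← hq, ← ncard_invariant c _
      (fun e he h hh => (W.comap N.mkQ).smul_mem (⟨e, he⟩ : Subfield.closure {(c : F)}) hh),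
      Finset.sum_boole, Finset.filter_filter, ← Set.ncard_coe_finset]
    simp only [coe_filter, mem_univ, true_and, and_assoc]
  rw [hn, ← hE]
  have hsum := sum_submodule_eq (Subfield.closure {(c : F)}) (F ⧸ N) fun l =>
    (-1 : ℚ) ^ l * (Nat.card (Subfield.closure {(c : F)}) : ℚ) ^ l.choose 2 *
      sFun (p ^ α) k (orderOf c) (p ^ (β + l * o))
  have hpow : ∀ l : ℕ, (p : ℚ) ^ (o * l.choose 2) =
      (Nat.card (Subfield.closure {(c : F)}) : ℚ) ^ l.choose 2 := by
    intro l
    rw [hE, pow_mul]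
    push_cast
    rfl
  simp only [hpow]
  -- Undo the grouping by dimension; then expand `sFun` as a count of sets `B` and exchange sums,
  -- leaving a Möbius sum for each `B`.
  trans ∑ W : Submodule (Subfield.closure {(c : F)}) (F ⧸ N),
    (-1 : ℚ) ^ finrank (Subfield.closure {(c : F)}) W *
      (Nat.card (Subfield.closure {(c : F)}) : ℚ) ^
        (finrank (Subfield.closure {(c : F)}) W).choose 2 *
      sFun (p ^ α) k (orderOf c) (p ^ (β + finrank (Subfield.closure {(c : F)}) W * o))
  · rw [hsum]
    exact Finset.sum_congr rfl fun l _ => by ring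
  · simp only [hinv, Finset.mul_sum, mul_ite, mul_one, mul_zero]
    rw [Finset.sum_comm]
    simp only [← Finset.sum_filter]
    rw [Finset.sum_congr rfl fun B hB =>
      sum_mobius_stabilizer c B (Finset.mem_filter.1 hB).2.2 N, Finset.sum_boole,
      Finset.filter_filter, ← Set.ncard_coe_finset]
    simp only [coe_filter, mem_univ, true_and, hNH]
    congr 2
    ext B
    simp only [Set.mem_ofPred_eq]
    tauto

end SubspaceSum

/-! ### The affine group and the shape of stabilizers. -/

section AffineGroup

variable {F : Type*} [Field F]

theorem aff_smul (a : Fˣ) (b x : F) : aff a b • x = a * x + b := rfl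

theorem AGL_ext {g h : AGL F} (h0 : g.1 0 0 = h.1 0 0) (h1 : g.1 0 1 = h.1 0 1) : g = h := by
  apply Subtype.ext
  ext i j
  fin_cases i <;> fin_cases j
  · exact h0
  · exact h1
  · exact g.2.1.trans h.2.1.symm
  · exact g.2.2.trans h.2.2.symm

theorem aff_injective {a a' : Fˣ} {b b' : F} (h : aff a b = aff a' b') : a = a' ∧ b = b' :=
  ⟨Units.ext (congrArg (fun g : AGL F => g.1 0 0) h), congrArg (fun g : AGL F => g.1 0 1) h⟩

theorem aff_mul (a a' : Fˣ) (b b' : F) : aff a b * aff a' b' = aff (a * a') (a * b' + b) := by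
  apply AGL_ext
  · change ((aff a b).1 * (aff a' b').1) 0 0 = _
    simp [aff, Matrix.GeneralLinearGroup.mkOfDetNeZero, Matrix.mul_apply, Fin.sum_univ_two]
  · change ((aff a b).1 * (aff a' b').1) 0 1 = _
    simp [aff, Matrix.GeneralLinearGroup.mkOfDetNeZero, Matrix.mul_apply, Fin.sum_univ_two]

theorem aff_one_zero : aff (1 : Fˣ) 0 = 1 := by
  apply AGL_ext
  · simp [aff, Matrix.GeneralLinearGroup.mkOfDetNeZero]
  · simp [aff, Matrix.GeneralLinearGroup.mkOfDetNeZero]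

theorem aff_inv (a : Fˣ) (b : F) : (aff a b)⁻¹ = aff a⁻¹ (-(a⁻¹ * b)) := by
  rw [inv_eq_iff_mul_eq_one, aff_mul]
  simp [aff_one_zero]

theorem exists_eq_aff (g : AGL F) : ∃ a b, g = aff a b := by
  have hdet : (g.1 : Matrix (Fin 2) (Fin 2) F).det = g.1 0 0 := by
    simp [Matrix.det_fin_two, g.2.1, g.2.2]
  have hne : g.1 0 0 ≠ 0 := by
    rw [← hdet]
    exact ((Matrix.isUnit_iff_isUnit_det _).1 g.1.isUnit).ne_zero
  exact ⟨Units.mk0 _ hne, g.1 0 1, AGL_ext rfl rfl⟩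

theorem aff_mem_subgroupS_iff {a : Fˣ} {H : AddSubgroup F}
    (hH : ∀ e ∈ Subfield.closure {(a : F)}, ∀ h ∈ H, e * h ∈ H) {c : Fˣ} {b : F} :
    aff c b ∈ subgroupS a 0 H ↔ c ∈ Subgroup.zpowers a ∧ b ∈ H := by
  constructor
  · suffices h : ∀ g ∈ subgroupS a 0 H, ∃ c ∈ Subgroup.zpowers a, ∃ b ∈ H, g = aff c b by
      intro hg
      obtain ⟨c', hc', b', hb', e⟩ := h _ hg
      obtain ⟨rfl, rfl⟩ := aff_injective e
      exact ⟨hc', hb'⟩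
    intro g hg
    induction hg using Subgroup.closure_induction with
    | mem g hg =>
      rcases hg with rfl | ⟨h, hh, rfl⟩
      · exact ⟨a, Subgroup.mem_zpowers a, 0, H.zero_mem, rfl⟩
      · exact ⟨1, one_mem _, h, hh, rfl⟩
    | one => exact ⟨1, one_mem _, 0, H.zero_mem, aff_one_zero.symm⟩
    | mul g g' _ _ ih ih' =>
      obtain ⟨c, hc, b, hb, rfl⟩ := ih
      obtain ⟨c', hc', b', hb', rfl⟩ := ih'
      exact ⟨_, mul_mem hc hc', _, H.add_mem (hH _ (zpowers_mem_closure hc) _ hb') hb,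
        aff_mul _ _ _ _⟩
    | inv g _ ih =>
      obtain ⟨c, hc, b, hb, rfl⟩ := ih
      exact ⟨_, inv_mem hc, _, H.neg_mem (hH _ (zpowers_mem_closure (inv_mem hc)) _ hb),
        aff_inv _ _⟩
  · rintro ⟨hc, hb⟩
    have h1 : aff 1 b ∈ subgroupS a 0 H := Subgroup.subset_closure (Or.inr ⟨b, hb, rfl⟩)
    have h2 : aff c 0 ∈ subgroupS a 0 H := by
      let f : Fˣ →* AGL F :=
        { toFun := fun c => aff c 0
          map_one' := aff_one_zero
          map_mul' := fun c c' => by rw [aff_mul]; simp }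
      have ha : a ∈ (subgroupS a 0 H).comap f := Subgroup.subset_closure (Or.inl rfl)
      exact Subgroup.zpowers_le.2 ha hc
    have := mul_mem h1 h2
    rw [aff_mul] at this
    simpa using this

theorem aff_one_mem_stabilizer {B : Set F} {t : F} :
    aff 1 t ∈ MulAction.stabilizer (AGL F) B ↔ t ∈ AddAction.stabilizer F B := by
  rw [MulAction.mem_stabilizer_set, AddAction.mem_stabilizer_set]
  simp only [aff_smul, Units.val_one, one_mul, vadd_eq_add, add_comm]

theorem aff_zero_mem_stabilizer {B : Set F} {c : Fˣ} :
    aff c 0 ∈ MulAction.stabilizer (AGL F) B ↔ c ∈ MulAction.stabilizer Fˣ B := by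
  rw [MulAction.mem_stabilizer_set, MulAction.mem_stabilizer_set]
  simp only [aff_smul, add_zero, Units.smul_def, smul_eq_mul]

/-- The stabilizer of `B` is `S(a, 0, H)` if and only if the translations stabilizing `B` are those
by `H` and the homotheties stabilizing `B` are the powers of `a`. -/
theorem stabilizer_eq_subgroupS_iff {a : Fˣ} (ha : a ≠ 1) {H : AddSubgroup F}
    (hH : ∀ e ∈ Subfield.closure {(a : F)}, ∀ h ∈ H, e * h ∈ H) (B : Set F) :
    MulAction.stabilizer (AGL F) B = subgroupS a 0 H ↔
      AddAction.stabilizer F B = H ∧ MulAction.stabilizer Fˣ B = Subgroup.zpowers a := by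
  constructor
  · intro h
    constructor
    · ext t
      rw [← aff_one_mem_stabilizer, h, aff_mem_subgroupS_iff hH, and_iff_right (one_mem _)]
    · ext c
      rw [← aff_zero_mem_stabilizer, h, aff_mem_subgroupS_iff hH, and_iff_left H.zero_mem]
  · rintro ⟨hK, hC⟩
    have hsplit : ∀ (c : Fˣ) (b : F), aff 1 b * aff c 0 = aff c b := by
      intro c b
      rw [aff_mul]
      simp
    have htr : ∀ b, aff 1 b ∈ MulAction.stabilizer (AGL F) B ↔ b ∈ H := fun b => by
      rw [aff_one_mem_stabilizer, hK]
    have hho : ∀ c, aff c 0 ∈ MulAction.stabilizer (AGL F) B ↔ c ∈ Subgroup.zpowers a := fun c => by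
      rw [aff_zero_mem_stabilizer, hC]
    ext g
    obtain ⟨c, b, rfl⟩ := exists_eq_aff g
    rw [aff_mem_subgroupS_iff hH]
    constructor
    · intro hg
      have hb : b ∈ H := by
        have ha0 := (hho a).2 (Subgroup.mem_zpowers a)
        -- The commutator with the homothety `a` is a translation, so it lands in `H`; as `a ≠ 1`,
        -- the factor `1 - a` can be divided out.
        have hcomm : aff c b * aff a 0 * (aff a 0 * aff c b)⁻¹ = aff 1 ((1 - a) * b) := by
          rw [mul_inv_eq_iff_eq_mul, aff_mul, aff_mul, aff_mul, one_mul, mul_comm a c]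
          congr 1
          push_cast
          ring
        have h1 : (1 - (a : F)) * b ∈ H := by
          rw [← htr, ← hcomm]
          exact mul_mem (mul_mem hg ha0) (inv_mem (mul_mem ha0 hg))
        have hne : 1 - (a : F) ≠ 0 := fun h0 => ha (Units.ext (sub_eq_zero.1 h0).symm)
        have := hH _ (inv_mem (sub_mem (one_mem _) (Subfield.subset_closure rfl))) _ h1
        rwa [inv_mul_cancel_left₀ hne] at this
      refine ⟨?_, hb⟩
      rw [← hho, ← mul_mem_cancel_left ((htr b).2 hb), hsplit]
      exact hg
    · rintro ⟨hc, hb⟩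
      rw [← hsplit]
      exact mul_mem ((htr b).2 hb) ((hho c).2 hc)

end AffineGroup

/-! ### Inclusion-exclusion over primes. -/

section PrimeSum

theorem prod_dvd_iff_subset_primeFactors {P : Finset ℕ} (hP : ∀ e ∈ P, e.Prime) {m : ℕ}
    (hm : m ≠ 0) : ∏ e ∈ P, e ∣ m ↔ P ⊆ m.primeFactors := by
  constructor
  · exact fun h e he => Nat.mem_primeFactors.2 ⟨hP e he, (Finset.dvd_prod_of_mem _ he).trans h, hm⟩
  · exact fun h => (Finset.prod_dvd_prod_of_subset _ _ _ h).trans (Nat.prod_primeFactors_dvd m)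

/-- If `m = d * m'`, the surviving `P` are the sets of primes dividing `m'`; their signs cancel
unless there are no such primes, that is `m' = 1`. -/
theorem sum_neg_one_pow_card_dvd {d n m : ℕ} (hd : d ≠ 0) (hn : n ≠ 0) (hm : m ∣ d * n) :
    ∑ P ∈ n.primeFactors.powerset, (if d * ∏ e ∈ P, e ∣ m then (-1 : ℚ) ^ #P else 0) =
      if m = d then 1 else 0 := by
  by_cases hdm : d ∣ m
  · obtain ⟨m, rfl⟩ := hdm
    have hmn : m ∣ n := Nat.dvd_of_mul_dvd_mul_left (Nat.pos_of_ne_zero hd) hm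
    have hm0 : m ≠ 0 := ne_zero_of_dvd_ne_zero hn hmn
    have hfil : {P ∈ n.primeFactors.powerset | d * ∏ e ∈ P, e ∣ d * m} =
        m.primeFactors.powerset := by
      ext P
      rw [mem_filter, mem_powerset, mem_powerset]
      rw [Nat.mul_dvd_mul_iff_left (Nat.pos_of_ne_zero hd)]
      constructor
      · rintro ⟨hP, h⟩
        exact (prod_dvd_iff_subset_primeFactors
          (fun e he => Nat.prime_of_mem_primeFactors (hP he)) hm0).1 h
      · intro h
        exact ⟨h.trans (Nat.primeFactors_mono hmn hn), (prod_dvd_iff_subset_primeFactors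
          (fun e he => Nat.prime_of_mem_primeFactors (h he)) hm0).2 h⟩
    rw [← sum_filter, hfil]
    have := congrArg (Int.cast : ℤ → ℚ) (sum_powerset_neg_one_pow_card (x := m.primeFactors))
    push_cast at this
    rw [this]
    refine if_congr ?_ rfl rfl
    rw [Nat.primeFactors_eq_empty, mul_eq_left₀ hd, or_iff_right hm0]
  · rw [if_neg fun h => hdm h.symm.dvd]
    exact sum_eq_zero fun P _ => if_neg fun h => hdm ((dvd_mul_right _ _).trans h)

end PrimeSum

end AffineLine

/-! ### Assembly of the two inversions. -/

theorem theorem4p3 {F : Type*} [Field F] [Finite F]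
    (p α : ℕ) (hp : p.Prime) (hq : Nat.card F = p ^ α)
    (γ : Fˣ) (hγ : ∀ x : Fˣ, x ∈ Subgroup.zpowers γ)
    (d : ℕ) (hd : 1 < d) (hdq : d ∣ p ^ α - 1)
    (H : AddSubgroup F)
    (hH : (γ ^ ((p ^ α - 1) / d), (0 : F), H) ∈ AffineLine.triples F)
    (β : ℕ) (hβ : Nat.card H = p ^ β)
    (k : ℕ) (hk : k ≤ p ^ α) :
    (AffineLine.numStab
        (AffineLine.subgroupS (γ ^ ((p ^ α - 1) / d)) (0 : F) H) k : ℚ) =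
      ∑ P ∈ (((AffineLine.multiplierSet H).ncard - 1) / d).primeFactors.powerset,
        ∑ l ∈ Finset.range ((α - β) / AffineLine.ordMod (d * ∏ e ∈ P, e) p + 1),
          (-1 : ℚ) ^ (P.card + l) *
            (p : ℚ) ^ (AffineLine.ordMod (d * ∏ e ∈ P, e) p * l.choose 2) *
            AffineLine.qBinom (p ^ AffineLine.ordMod (d * ∏ e ∈ P, e) p)
              ((α - β) / AffineLine.ordMod (d * ∏ e ∈ P, e) p) l *
            AffineLine.sFun (p ^ α) k (d * ∏ e ∈ P, e)
              (p ^ (β + l * AffineLine.ordMod (d * ∏ e ∈ P, e) p)) := by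
  classical
  open AffineLine in
  have := Fintype.ofFinite (Set F)
  have hcardU : Nat.card Fˣ = p ^ α - 1 := by rw [Nat.card_units, hq]
  have hord : ∀ u, u ∣ p ^ α - 1 → orderOf (γ ^ ((p ^ α - 1) / u)) = u := by
    intro u hu
    have h0 : p ^ α - 1 ≠ 0 := hcardU ▸ Nat.card_pos.ne'
    rw [← orderOf_eq_card_of_forall_mem_zpowers hγ] at hcardU
    rw [← hcardU] at hu h0 ⊢
    exact orderOf_pow_orderOf_div h0 hu
  have hstab : ∀ e ∈ Subfield.closure {((γ ^ ((p ^ α - 1) / d) : Fˣ) : F)}, ∀ h ∈ H, e * h ∈ H :=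
    hH.1
  have horda := hord d hdq
  have haM : ((γ ^ ((p ^ α - 1) / d) : Fˣ) : F) ∈ multiplierSubfield H :=
    hstab _ (Subfield.subset_closure rfl)
  have ha1 : γ ^ ((p ^ α - 1) / d) ≠ 1 := by
    intro h
    rw [h, orderOf_one] at horda
    omega
  have hM : (multiplierSet H).ncard - 1 = Nat.card (unitsSubgroup (multiplierSubfield H)) := by
    rw [natCard_unitsSubgroup]
    rfl
  have hdM : d ∣ Nat.card (unitsSubgroup (multiplierSubfield H)) := by
    rw [← horda, ← mem_subgroup_units_iff, mem_unitsSubgroup]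
    exact haM
  have hMq : Nat.card (unitsSubgroup (multiplierSubfield H)) ∣ p ^ α - 1 :=
    hcardU ▸ Subgroup.card_subgroup_dvd_card _
  rw [hM]
  obtain ⟨n, hn⟩ := hdM
  have hn0 : n ≠ 0 := by
    rintro rfl
    exact Nat.card_pos.ne' hn
  have hnd : Nat.card (unitsSubgroup (multiplierSubfield H)) / d = n := by
    rw [hn, Nat.mul_div_cancel_left _ (by omega)]
  rw [hnd]
  -- Since `d * ∏ P` divides `|H'| - 1 = d * n`, an element of that order lies in `H'`, so `H` is a
  -- space over the field it generates.
  have hinner : ∀ P ∈ n.primeFactors.powerset, orderOf (γ ^ ((p ^ α - 1) / (d * ∏ e ∈ P, e))) =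
      d * ∏ e ∈ P, e ∧
      ((γ ^ ((p ^ α - 1) / (d * ∏ e ∈ P, e)) : Fˣ) : F) ∈ multiplierSubfield H := by
    intro P hP
    have hPn : d * ∏ e ∈ P, e ∣ Nat.card (unitsSubgroup (multiplierSubfield H)) := by
      rw [hn]
      exact mul_dvd_mul_left d ((prod_dvd_iff_subset_primeFactors (fun e he =>
        Nat.prime_of_mem_primeFactors (Finset.mem_powerset.1 hP he)) hn0).2
        (Finset.mem_powerset.1 hP))
    have h1 := hord _ (hPn.trans hMq)
    refine ⟨h1, ?_⟩
    rw [← mem_unitsSubgroup, mem_subgroup_units_iff, h1]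
    exact hPn
  have hterm : ∀ P ∈ n.primeFactors.powerset,
      ∑ l ∈ Finset.range ((α - β) / ordMod (d * ∏ e ∈ P, e) p + 1),
        (-1 : ℚ) ^ (P.card + l) * (p : ℚ) ^ (ordMod (d * ∏ e ∈ P, e) p * l.choose 2) *
          qBinom (p ^ ordMod (d * ∏ e ∈ P, e) p) ((α - β) / ordMod (d * ∏ e ∈ P, e) p) l *
          sFun (p ^ α) k (d * ∏ e ∈ P, e) (p ^ (β + l * ordMod (d * ∏ e ∈ P, e) p)) =
      ∑ B : Set F with B.ncard = k ∧ AddAction.stabilizer F B = H,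
        if d * ∏ e ∈ P, e ∣ Nat.card (MulAction.stabilizer Fˣ B) then (-1 : ℚ) ^ P.card else 0 := by
    intro P hP
    obtain ⟨h1, h2⟩ := hinner P hP
    have h3 := sum_qBinom_mul_sFun hp hq H hβ _ h2 k
    have hmem : ∀ B : Set F, γ ^ ((p ^ α - 1) / (d * ∏ e ∈ P, e)) ∈ MulAction.stabilizer Fˣ B ↔
        d * ∏ e ∈ P, e ∣ Nat.card (MulAction.stabilizer Fˣ B) := fun B => by
      rw [mem_subgroup_units_iff, h1]
    simp only [hmem, h1] at h3
    rw [← Finset.sum_filter, Finset.sum_const, Finset.filter_filter, nsmul_eq_mul,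
      ← Set.ncard_coe_finset (Finset.filter _ _)]
    simp only [Finset.coe_filter, Finset.mem_univ, true_and]
    rw [← h3, Finset.sum_mul]
    exact Finset.sum_congr rfl fun l _ => by rw [pow_add]; ring
  rw [Finset.sum_congr rfl hterm, Finset.sum_comm]
  have hB : ∀ B ∈ (Finset.univ.filter fun B : Set F =>
      B.ncard = k ∧ AddAction.stabilizer F B = H),
      ∑ P ∈ n.primeFactors.powerset,
        (if d * ∏ e ∈ P, e ∣ Nat.card (MulAction.stabilizer Fˣ B) then (-1 : ℚ) ^ P.card else 0) =
      if MulAction.stabilizer Fˣ B = Subgroup.zpowers (γ ^ ((p ^ α - 1) / d)) then 1 else 0 := by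
    intro B hB
    obtain ⟨-, -, hBH⟩ := Finset.mem_filter.1 hB
    have hle : MulAction.stabilizer Fˣ B ≤ unitsSubgroup (multiplierSubfield H) := fun c hc =>
      mem_unitsSubgroup.2 (hBH ▸ stabilizer_le_multiplier hc)
    rw [sum_neg_one_pow_card_dvd (by omega) hn0 (hn ▸ Subgroup.card_dvd_of_le hle)]
    -- Subgroups of the cyclic group `Fˣ` are determined by their order.
    refine if_congr ⟨fun h => ?_, fun h => ?_⟩ rfl rfl
    · ext x
      rw [mem_subgroup_units_iff, mem_subgroup_units_iff, h, Nat.card_zpowers, horda]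
    · rw [h, Nat.card_zpowers, horda]
  rw [Finset.sum_congr rfl hB, Finset.sum_boole, Finset.filter_filter, ← Set.ncard_coe_finset,
    numStab]
  simp only [Finset.coe_filter, Finset.mem_univ, true_and, and_assoc,
    stabilizer_eq_subgroupS_iff ha1 hstab]
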